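/- All functions, maps and hypersurfaces are $\mathcal C^\infty$-smooth. Let $S\subset\mathbb C^2$ be a (not necessarily compact) oriented embedded real hypersurface with defining function $\rho$: $\rho$ is real-valued and smooth on an open set $U$, $S=\{z\in U:\rho(z)=0\}$, and $d\rho\ne0$ along $S$. Let $H_zS=T_zS\cap iT_zS$ be the maximal complex subspace of $T_zS$. Assume that $S$ is strongly $\mathbb C$-convex, i.e. the second fundamental form of $S$ (the real Hessian of $\rho$ restricted to $T_zS$, up to a positive factor) is positive definite on $H_zS$ for every $z\in S$, and that no complex tangent line $z+H_zS$ ($z\in S$) passes through the origin. Put $$w_j=\frac{\partial\rho/\partial z_j}{z_1\,\partial\rho/\partial z_1+z_2\,\partial\rho/\partial z_2}\qquad(j=1,2);$$ the map $z\mapsto w(z)=(w_1(z),w_2(z))$ is a local diffeomorphism of a neighbourhood of $S$ into $\mathbb C^2$. Let $\partial/\partial w_1,\partial/\partial w_2$ be the pull-backs under this map of the coordinate vector fields, and let $$V=z_2\frac{\partial}{\partial w_1}-z_1\frac{\partial}{\partial w_2},$$ which along $S$ is tangent to $S$ and depends only on $S$. A smooth complex-valued function on a relatively open subset of $S$ is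 called CR if it is annihilated by all tangential vectors of type $(0,1)$, and dual-CR if it is annihilated by $\overline V$. Let $W$ be a simply-connected relatively open subset of $S$, and let $u\colon W\to\mathbb C$ be a function such that every point of $W$ has a relatively open neighbourhood in $W$ on which $u$ is the sum of a CR function and a dual-CR function. Then there are a CR function $f$ on $W$ and a dual-CR function $g$ on $W$ with $u=f+g$ on all of $W$. -/

import Mathlib

open scoped ContDiff

namespace DualCR

/-- `ℂ²` with coordinates `z.1, z.2`, regarded also as a four-dimensional real vector space.
Only its topology and its smooth structure are used, so the choice of norm is immaterial. -/
abbrev C2 : Type := ℂ × ℂ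

/-- `S` is a smooth embedded real hypersurface of `ℂ²` with defining function `ρ`:
`ρ` is smooth on the open set `U`, `S` is its zero set there, and `dρ ≠ 0` along `S`.
The hypersurface is oriented by `ρ`; it need be neither compact nor closed in `ℂ²`. -/
structure IsDefiningFunction (ρ : C2 → ℝ) (U S : Set C2) : Prop where
  isOpen : IsOpen U
  contDiffOn : ContDiffOn ℝ ∞ ρ U
  zeroSet : S = {z | z ∈ U ∧ ρ z = 0}
  fderiv_ne_zero : ∀ z ∈ S, fderiv ℝ ρ z ≠ 0

/-- The maximal complex subspace `H_z S = T_z S ∩ i T_z S` of the tangent space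
`T_z S = ker dρ(z)`. -/
def complexTangent (ρ : C2 → ℝ) (z : C2) : Set C2 :=
  {v | fderiv ℝ ρ z v = 0 ∧ fderiv ℝ ρ z (Complex.I • v) = 0}

/-- Strong `ℂ`-convexity: the second fundamental form of `S` (which is a positive multiple of the
real Hessian of `ρ` on `T_z S`) is positive definite on `H_z S` for every `z ∈ S`. -/
def IsStronglyCConvex (ρ : C2 → ℝ) (S : Set C2) : Prop :=
  ∀ z ∈ S, ∀ v ∈ complexTangent ρ z, v ≠ 0 → 0 < fderiv ℝ (fun y => fderiv ℝ ρ y) z v v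

/-- No complex tangent line `z + H_z S` of `S` passes through the origin. -/
def TangentLinesAvoidOrigin (ρ : C2 → ℝ) (S : Set C2) : Prop :=
  ∀ z ∈ S, ∀ v ∈ complexTangent ρ z, z + v ≠ 0

/-- `∂ρ/∂z₁`. -/
noncomputable def dz1 (ρ : C2 → ℝ) (z : C2) : ℂ :=
  (1 / 2) * ((fderiv ℝ ρ z (1, 0) : ℂ) - Complex.I * (fderiv ℝ ρ z (Complex.I, 0) : ℂ))

/-- `∂ρ/∂z₂`. -/
noncomputable def dz2 (ρ : C2 → ℝ) (z : C2) : ℂ :=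
  (1 / 2) * ((fderiv ℝ ρ z (0, 1) : ℂ) - Complex.I * (fderiv ℝ ρ z (0, Complex.I) : ℂ))

/-- The dual map `z ↦ w(z) = (w₁, w₂)`, with
`w_j = (∂ρ/∂z_j) / (z₁ ∂ρ/∂z₁ + z₂ ∂ρ/∂z₂)`.  On `S` it depends on `S` only; off `S`, this
formula is a smooth extension to a neighbourhood of `S` when no complex tangent line passes through
the origin, and, as `z₁w₁ + z₂w₂ = 1` holds identically there, it is a local diffeomorphism near
`S` for strongly `ℂ`-convex `S`. -/
noncomputable def dualMap (ρ : C2 → ℝ) (z : C2) : C2 :=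
  (dz1 ρ z / (z.1 * dz1 ρ z + z.2 * dz2 ρ z), dz2 ρ z / (z.1 * dz1 ρ z + z.2 * dz2 ρ z))

/-- A complexified tangent vector `re + i im` of `ℂ²`, with `re`, `im` real tangent vectors.
(The `i` here is that of the complexification, not the complex structure of `ℂ²`.) -/
structure CVec where
  re : C2
  im : C2

namespace CVec

/-- The action of a complexified tangent vector at `z` on a complex-valued function. -/
noncomputable def apply (L : CVec) (F : C2 → ℂ) (z : C2) : ℂ :=
  fderiv ℝ F z L.re + Complex.I * fderiv ℝ F z L.im

/-- The conjugate vector. -/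
def conj (L : CVec) : CVec := ⟨L.re, -L.im⟩

/-- The vector `a₁ ∂/∂z₁ + a₂ ∂/∂z₂` of type `(1,0)`. -/
noncomputable def holo (a : C2) : CVec :=
  ⟨(1 / 2 : ℂ) • a, -((Complex.I / 2) • a)⟩

/-- The image of a complexified tangent vector under (the complexification of) a real-linear
map. -/
noncomputable def map (A : C2 →L[ℝ] C2) (L : CVec) : CVec := ⟨A L.re, A L.im⟩

end CVec

/-- The vector field `V = z₂ ∂/∂w₁ - z₁ ∂/∂w₂` at `z`, where `∂/∂w_j` is the pull-back of the
coordinate field by the local diffeomorphism `z ↦ w(z)`. It is tangent to `S` at points of `S`. -/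
noncomputable def dualField (ρ : C2 → ℝ) (z : C2) : CVec :=
  CVec.map (fderiv ℝ (dualMap ρ) z).inverse (CVec.holo (z.2, -z.1))

/-- `f` is a smooth function on `W ⊆ S` (it has a smooth extension near each point of `W`) that is
annihilated at each `z ∈ W` by all vectors of `Λ z`.  The vectors of `Λ z` are meant to be tangent
to `S`, so that their action does not depend on the extension. -/
def SmoothAnnihilated (Λ : C2 → Set CVec) (W : Set C2) (f : C2 → ℂ) : Prop :=
  ∀ p ∈ W, ∃ N : Set C2, IsOpen N ∧ p ∈ N ∧ ∃ F : C2 → ℂ, ContDiffOn ℝ ∞ F N ∧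
    (∀ z ∈ N ∩ W, F z = f z) ∧ ∀ z ∈ N ∩ W, ∀ L ∈ Λ z, L.apply F z = 0

/-- CR functions on `W`: smooth, and annihilated by the tangential vectors of type `(0,1)`.
Only the values of `f` on `W` matter. -/
def IsCROn (ρ : C2 → ℝ) (W : Set C2) (f : C2 → ℂ) : Prop :=
  SmoothAnnihilated (fun z => {L | ∃ v ∈ complexTangent ρ z, L = (CVec.holo v).conj}) W f

/-- Dual-CR functions on `W`: smooth, and annihilated by the conjugate of `V`.
Only the values of `g` on `W` matter. -/
def IsDualCROn (ρ : C2 → ℝ) (W : Set C2) (g : C2 → ℂ) : Prop :=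
  SmoothAnnihilated (fun z => {(dualField ρ z).conj}) W g

/-- `u` is on `W` the sum of a CR function and a dual-CR function. -/
def IsDecomposableOn (ρ : C2 → ℝ) (W : Set C2) (u : C2 → ℂ) : Prop :=
  ∃ f g : C2 → ℂ, IsCROn ρ W f ∧ IsDualCROn ρ W g ∧ ∀ z ∈ W, u z = f z + g z

/-- Every point of `W` has a relatively open neighbourhood in `W` on which `u` is the sum of a CR
function and a dual-CR function. -/
def IsLocallyDecomposableOn (ρ : C2 → ℝ) (W : Set C2) (u : C2 → ℂ) : Prop :=
  ∀ p ∈ W, ∃ O : Set C2, IsOpen O ∧ p ∈ O ∧ IsDecomposableOn ρ (W ∩ O) u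

end DualCR

/-! ### Gluing along a simply connected space -/

open Topology

/-! The point is that a function both CR and dual-CR is locally constant. Where two local
decompositions overlap, `f i - f j = g j - g i` is such a function, so the obstruction to gluing is
a cocycle of locally constant functions, i.e. a covering space with fibre ℂ. Simple connectivity
gives it a global section, which corrects the `f i` by constants to a global CR function;
subtracting that from `u` leaves a dual-CR function.

Local constancy has two steps. CR makes the differential complex-linear on the complex line `H_z S`.
The conjugate of `V` also lies in the complexification of `H_z S`, and positivity of the Hessian
there makes it independent of the `(0,1)` direction, so the differential vanishes on `H_z S`
(`apply_eq_zero_of_mem_complexTangent`). Positivity also makes the Levi form positive, so a bracket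
of sections of `HS` supplies the missing tangent direction (`fderiv_eq_zero_of_complexTangent`). -/

/-- A locally defined function whose local determinations differ by locally constant functions has
a global determination on a simply connected space. -/
theorem exists_eventually_sub_eq_of_simplyConnected {X ι G : Type*} [TopologicalSpace X]
    [SimplyConnectedSpace X] [LocallyPathConnectedSpace X] [AddCommGroup G]
    (B : ι → Set X) (hB : ∀ i, IsOpen (B i)) (hcov : ∀ x, ∃ i, x ∈ B i) (f : ι → X → G)
    (hf : ∀ i j, ∀ x ∈ B i ∩ B j, ∀ᶠ y in 𝓝 x, f i y - f j y = f i x - f j x) :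
    ∃ F : X → G, ∀ i, ∀ x ∈ B i, ∀ᶠ y in 𝓝 x, F y - f i y = F x - f i x := by
  -- With the discrete topology on `G`, local constancy of the differences is exactly continuity of
  -- the coordinate changes, and the bundle is a covering.
  let _ : TopologicalSpace G := ⊥
  have _ : DiscreteTopology G := ⟨rfl⟩
  choose idx hidx using hcov
  let Z : FiberBundleCore ι X G :=
    { baseSet := B
      isOpen_baseSet := hB
      indexAt := idx
      mem_baseSet_at := hidx
      coordChange := fun i j x c => c + (f i x - f j x)
      coordChange_self := by simp
      continuousOn_coordChange := by
        rintro i j ⟨x, c⟩ ⟨hx, -⟩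
        refine ContinuousAt.continuousWithinAt (ContinuousAt.add continuousAt_snd ?_)
        have h1 : ContinuousAt (fun y => f i y - f j y) x :=
          (continuousAt_const (y := f i x - f j x)).congr
            ((hf i j x hx).mono fun y hy => hy.symm)
        exact ContinuousAt.comp (x := (x, c)) (g := fun y => f i y - f j y) h1 continuousAt_fst
      coordChange_comp := by intros; abel }
  have hcover : IsCoveringMap Z.proj := FiberBundle.isCoveringMap (F := G) (E := Z.Fiber)
  obtain ⟨x₀⟩ : Nonempty X := inferInstance
  obtain ⟨s, ⟨-, hs⟩, -⟩ := hcover.existsUnique_continuousMap_lifts (ContinuousMap.id X) x₀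
    (⟨x₀, (0 : G)⟩ : Z.TotalSpace) rfl
  have hs1 : ∀ x, (s x).1 = x := fun x => congrFun hs x
  let c : X → G := fun x => (s x).2
  -- `c` is read in the trivialization `idx x`, which jumps with `x`. Read in the fixed
  -- trivialization `i`, the section is `c + f (idx ·) - f i`, hence locally constant.
  have key : ∀ i, ∀ x ∈ B i, ContinuousAt
      (fun y => c y + (f (idx (s y).1) (s y).1 - f i (s y).1)) x := by
    intro i x hx
    have h1 : ContinuousAt (Z.localTriv i) (s x) := by
      apply (Z.localTriv i).continuousAt
      rw [Z.mem_localTriv_source, hs1]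
      exact hx
    exact (continuous_snd.continuousAt.comp (h1.comp s.continuous.continuousAt) :)
  refine ⟨fun x => c x + f (idx x) x, fun i x hx => ?_⟩
  have h2 := (key i x hx).eventually_mem ((isOpen_discrete {_}).mem_nhds rfl)
  filter_upwards [h2] with y hy
  simpa [hs1, add_sub_assoc] using hy

/-! ### Calculus on a hypersurface -/

namespace DualCR

/-- Near each of its points a hypersurface is the image of a piece of a hyperplane. -/
theorem IsDefiningFunction.exists_flattening {ρ : C2 → ℝ} {U S : Set C2}
    (hS : IsDefiningFunction ρ U S) {p : C2} (hp : p ∈ S) {N : Set C2} (hN : N ∈ 𝓝 p) :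
    ∃ (ℓ : C2 →L[ℝ] ℝ) (B : Set C2) (Ψ : C2 → C2) (q : C2), Convex ℝ B ∧ IsOpen B ∧ q ∈ B ∧
      Ψ q = p ∧ DifferentiableOn ℝ Ψ B ∧ IsOpen (Ψ '' B) ∧ Ψ '' B ⊆ N ∩ U ∧
      (∀ x ∈ B, ρ (Ψ x) = ℓ x) ∧ ℓ = fderiv ℝ ρ p ∧
      HasFDerivAt Ψ (ContinuousLinearMap.id ℝ C2) q := by
  have hpU : p ∈ U := (hS.zeroSet.subset hp).1
  have hUp : U ∈ 𝓝 p := hS.isOpen.mem_nhds hpU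
  have hcd : ContDiffAt ℝ ∞ ρ p := hS.contDiffOn.contDiffAt hUp
  set ℓ := fderiv ℝ ρ p with hℓ
  have hρd : HasFDerivAt ρ ℓ p := (hcd.differentiableAt (by simp)).hasFDerivAt
  obtain ⟨n, hn⟩ : ∃ n, ℓ n = 1 := by
    obtain ⟨m, hm⟩ : ∃ m, ℓ m ≠ 0 := by
      by_contra! h
      exact hS.fderiv_ne_zero p hp (ContinuousLinearMap.ext h)
    exact ⟨(ℓ m)⁻¹ • m, by simp [hm]⟩
  -- Since `ℓ n = 1`, this gives `ℓ ∘ Φ = ρ`, and the derivative of `Φ` at `p` is the identity.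
  let Φ : C2 → C2 := fun z => z + (ρ z - ℓ z) • n
  have hΦc : ContDiffAt ℝ ∞ Φ p :=
    contDiffAt_id.add ((hcd.sub ℓ.contDiff.contDiffAt).smul contDiffAt_const)
  have hΦd : HasFDerivAt Φ ((ContinuousLinearEquiv.refl ℝ C2 : C2 ≃L[ℝ] C2) : C2 →L[ℝ] C2) p := by
    have := (hasFDerivAt_id (𝕜 := ℝ) p).add ((hρd.sub ℓ.hasFDerivAt).smul_const n)
    convert! this using 1
    ext v <;> simp
  have hΦℓ : ∀ z, ℓ (Φ z) = ρ z := by intro z; simp [Φ, hn]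
  let e := hΦc.toOpenPartialHomeomorph Φ hΦd (by simp)
  have hpe : p ∈ e.source := hΦc.mem_toOpenPartialHomeomorph_source hΦd (by simp)
  have heΦ : ∀ z, e z = Φ z := fun _ => rfl
  have hqe : Φ p ∈ e.target := hΦc.image_mem_toOpenPartialHomeomorph_target hΦd (by simp)
  have hqp : e.symm (Φ p) = p := e.left_inv hpe
  have hsd : HasStrictFDerivAt e.symm
      ((ContinuousLinearEquiv.refl ℝ C2 : C2 ≃L[ℝ] C2).symm : C2 →L[ℝ] C2) (Φ p) :=
    (hΦc.hasStrictFDerivAt' hΦd (by simp)).to_localInverse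
  have hsc : ContDiffAt ℝ ∞ e.symm (Φ p) := hΦc.to_localInverse hΦd (by simp)
  have hs1 : ∀ᶠ x in 𝓝 (Φ p), DifferentiableAt ℝ e.symm x := by
    filter_upwards [(hsc.of_le (by simp : (1 : WithTop ℕ∞) ≤ ∞)).eventually (by simp)] with x hx
    exact hx.differentiableAt (by simp)
  have hs2 : ∀ᶠ x in 𝓝 (Φ p), e.symm x ∈ N ∩ U := by
    apply hsc.continuousAt.eventually_mem
    rw [hqp]
    exact Filter.inter_mem hN hUp
  obtain ⟨r, hr, hball⟩ := Metric.eventually_nhds_iff_ball.1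
    ((hs1.and hs2).and (e.open_target.mem_nhds hqe))
  refine ⟨ℓ, Metric.ball (Φ p) r, e.symm, Φ p, convex_ball _ _, Metric.isOpen_ball,
    Metric.mem_ball_self hr, hqp, fun x hx => (hball x hx).1.1.differentiableWithinAt, ?_, ?_, ?_,
    rfl, hsd.hasFDerivAt⟩
  · exact e.symm.isOpen_image_of_subset_source Metric.isOpen_ball fun x hx => (hball x hx).2
  · rintro _ ⟨x, hx, rfl⟩
    exact (hball x hx).1.2
  · intro x hx
    rw [← hΦℓ, ← heΦ, e.right_inv (hball x hx).2]

/-- In flattened coordinates small pieces of `S` are hyperplane sections of balls, hence convex. The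
lifting argument on `W` requires this. -/
theorem IsDefiningFunction.locallyPathConnectedSpace {ρ : C2 → ℝ} {U S O : Set C2}
    (hS : IsDefiningFunction ρ U S) (hO : IsOpen O) :
    LocallyPathConnectedSpace (S ∩ O : Set C2) := by
  refine ⟨fun x => ?_⟩
  rw [Filter.hasBasis_iff]
  intro t
  constructor
  · intro ht
    obtain ⟨N, hN, hNt⟩ := (mem_nhds_subtype _ _ _).1 ht
    obtain ⟨ℓ, B, Ψ, q, hBc, hBo, hq, hqp, hd, hio, hsub, hρ, -, -⟩ :=
      hS.exists_flattening x.2.1 (Filter.inter_mem hN (hO.mem_nhds x.2.2))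
    have himg : (Subtype.val '' (Subtype.val ⁻¹' (Ψ '' B) : Set (S ∩ O : Set C2)))
        = Ψ '' (B ∩ {y | ℓ y = 0}) := by
      rw [Subtype.image_preimage_coe]
      ext y
      constructor
      · rintro ⟨⟨hyS, -⟩, b, hb, rfl⟩
        rw [hS.zeroSet] at hyS
        exact ⟨b, ⟨hb, by rw [Set.mem_ofPred_eq, ← hρ b hb]; exact hyS.2⟩, rfl⟩
      · rintro ⟨b, ⟨hb, hb0⟩, rfl⟩
        have h1 := hsub ⟨b, hb, rfl⟩
        refine ⟨⟨?_, h1.1.2⟩, b, hb, rfl⟩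
        rw [hS.zeroSet]
        exact ⟨h1.2, by rw [hρ b hb]; exact hb0⟩
    refine ⟨Subtype.val ⁻¹' (Ψ '' B), ⟨?_, ?_⟩, ?_⟩
    · exact (hio.preimage continuous_subtype_val).mem_nhds ⟨q, hq, hqp⟩
    · rw [Topology.IsInducing.subtypeVal.isPathConnected_iff, himg]
      have hconv : Convex ℝ (B ∩ {y | ℓ y = 0}) :=
        hBc.inter (convex_hyperplane ℓ.toLinearMap.isLinear 0)
      have hxS : ρ x = 0 := (hS.zeroSet.subset x.2.1).2
      refine (hconv.isPathConnected ⟨q, hq, ?_⟩).image' (hd.continuousOn.mono Set.inter_subset_left)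
      rw [Set.mem_ofPred_eq, ← hρ q hq, hqp, hxS]
    · intro y hy
      exact hNt (hsub hy).1.1
  · rintro ⟨s, ⟨hs, -⟩, hst⟩
    exact Filter.mem_of_superset hs hst

/-- The derivative of a function vanishing on a hypersurface vanishes on the tangent space. -/
theorem IsDefiningFunction.fderiv_apply_eq_zero {ρ : C2 → ℝ} {U S : Set C2}
    (hS : IsDefiningFunction ρ U S) {p : C2} (hp : p ∈ S) {h : C2 → ℂ} {h' : C2 →L[ℝ] ℂ}
    (hd : HasFDerivAt h h' p) (h0 : ∀ᶠ z in 𝓝 p, z ∈ S → h z = 0) {v : C2}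
    (hv : fderiv ℝ ρ p v = 0) : h' v = 0 := by
  obtain ⟨ℓ, B, Ψ, q, -, hBo, hq, hqp, -, -, hsub, hρ, hℓ, hΨ⟩ := hS.exists_flattening hp h0
  have hρp : ρ p = 0 := (hS.zeroSet.subset hp).2
  -- As `ℓ v = 0`, `Ψ` carries this line into `S`, and with velocity `v` at `p` because its
  -- derivative at `q` is the identity.
  have hγ : HasDerivAt (fun t : ℝ => q + t • v) v 0 := by
    simpa using ((hasDerivAt_id (0 : ℝ)).smul_const v).const_add q
  have hq0 : q + (0 : ℝ) • v = q := by simp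
  have h1 : HasDerivAt (fun t : ℝ => h (Ψ (q + t • v))) (h' v) 0 := by
    have a1 : HasFDerivAt Ψ (ContinuousLinearMap.id ℝ C2) (q + (0 : ℝ) • v) := by rwa [hq0]
    have a2 : HasFDerivAt h h' (Ψ (q + (0 : ℝ) • v)) := by rwa [hq0, hqp]
    have a3 := a1.comp_hasDerivAt (0 : ℝ) hγ
    exact a2.comp_hasDerivAt (0 : ℝ) a3
  have h2 : ∀ᶠ t : ℝ in 𝓝 0, h (Ψ (q + t • v)) = 0 := by
    have : ∀ᶠ t : ℝ in 𝓝 0, q + t • v ∈ B :=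
      hγ.continuousAt.eventually_mem (by rw [hq0]; exact hBo.mem_nhds hq)
    filter_upwards [this] with t ht
    have h3 := hsub ⟨_, ht, rfl⟩
    refine h3.1 ?_
    rw [hS.zeroSet]
    refine ⟨h3.2, ?_⟩
    rw [hρ _ ht, map_add, map_smul, ← hρ q hq, hqp, hρp, hℓ, hv]
    simp
  exact h1.unique ((hasDerivAt_const (0 : ℝ) (0 : ℂ)).congr_of_eventuallyEq h2)

/-- A function all of whose tangential derivatives vanish is locally constant on a hypersurface. -/
theorem IsDefiningFunction.eventually_eq_of_fderiv_eq_zero {ρ : C2 → ℝ} {U S : Set C2}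
    (hS : IsDefiningFunction ρ U S) {p : C2} (hp : p ∈ S) {N : Set C2} (hN : N ∈ 𝓝 p)
    {F : C2 → ℂ} (hF : ∀ z ∈ N ∩ S, DifferentiableAt ℝ F z)
    (h0 : ∀ z ∈ N ∩ S, ∀ v, fderiv ℝ ρ z v = 0 → fderiv ℝ F z v = 0) :
    ∀ᶠ z in 𝓝 p, z ∈ S → F z = F p := by
  obtain ⟨ℓ, B, Ψ, q, hBc, hBo, hq, hqp, hd, hio, hsub, hρ, -, -⟩ := hS.exists_flattening hp hN
  have hρp : ρ p = 0 := (hS.zeroSet.subset hp).2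
  let K := LinearMap.ker ℓ.toLinearMap
  let B' : Set K := K.subtypeL ⁻¹' B
  have hB'o : IsOpen B' := hBo.preimage K.subtypeL.continuous
  have hB'c : Convex ℝ B' := hBc.linear_preimage K.subtype
  have hmem : ∀ x : K, x ∈ B' → Ψ x ∈ N ∩ S := by
    intro x hx
    have h3 := hsub ⟨(x : C2), hx, rfl⟩
    refine ⟨h3.1, ?_⟩
    rw [hS.zeroSet]
    exact ⟨h3.2, (hρ _ hx).trans x.2⟩
  have hder : ∀ x : K, x ∈ B' → HasFDerivAt (fun y : K => F (Ψ y)) (0 : K →L[ℝ] ℂ) x := by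
    intro x hx
    have hΨ : HasFDerivAt Ψ (fderiv ℝ Ψ x) (x : C2) :=
      (hd.differentiableAt (hBo.mem_nhds hx)).hasFDerivAt
    have h3 := hsub ⟨(x : C2), hx, rfl⟩
    have hρd : HasFDerivAt ρ (fderiv ℝ ρ (Ψ x)) (Ψ x) :=
      ((hS.contDiffOn.contDiffAt (hS.isOpen.mem_nhds h3.2)).differentiableAt
        (by simp)).hasFDerivAt
    -- Differentiating `ρ ∘ Ψ = ℓ` shows that the derivative of `Ψ` maps `ker ℓ` into the tangent
    -- space of `S`.
    have hcomp : (fderiv ℝ ρ (Ψ x)).comp (fderiv ℝ Ψ x) = ℓ := by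
      refine (hρd.comp (x : C2) hΨ).unique (ℓ.hasFDerivAt.congr_of_eventuallyEq ?_)
      filter_upwards [hBo.mem_nhds hx] with y hy
      exact hρ y hy
    have hFd := (hF _ (hmem x hx)).hasFDerivAt
    have := (hFd.comp (x : C2) hΨ).comp x K.subtypeL.hasFDerivAt
    convert! this using 1
    ext v
    refine (h0 _ (hmem x hx) _ ?_).symm
    have h5 := DFunLike.congr_fun hcomp (v : C2)
    exact h5.trans v.2
  have hqK : q ∈ K := by
    change ℓ q = 0
    rw [← hρ q hq, hqp, hρp]
  filter_upwards [hio.mem_nhds ⟨q, hq, hqp⟩] with z hz hzS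
  obtain ⟨x, hx, rfl⟩ := hz
  have hxK : x ∈ K := by
    change ℓ x = 0
    rw [hS.zeroSet] at hzS
    rw [← hρ x hx]; exact hzS.2
  have := hB'o.is_const_of_fderiv_eq_zero hB'c.isPreconnected
    (fun y hy => (hder y hy).differentiableAt.differentiableWithinAt)
    (fun y hy => (hder y hy).fderiv) (x := ⟨x, hxK⟩) (y := ⟨q, hqK⟩) hx hq
  simpa [hqp] using this

/-! ### Complex gradient and complex tangent space -/

/-- The complex-bilinear pairing of `ℂ²` with itself. -/
def pair (a b : C2) : ℂ := a.1 * b.1 + a.2 * b.2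

/-- The complex-linear part `∂ℓ` of a real functional `ℓ`, as a vector of coefficients. -/
noncomputable def cplxPart : (C2 →L[ℝ] ℝ) →L[ℝ] C2 :=
  LinearMap.toContinuousLinearMap
    { toFun := fun ℓ => ((1 / 2) * ((ℓ (1, 0) : ℂ) - Complex.I * (ℓ (Complex.I, 0) : ℂ)),
        (1 / 2) * ((ℓ (0, 1) : ℂ) - Complex.I * (ℓ (0, Complex.I) : ℂ)))
      map_add' := by intro a b; ext <;> simp <;> ring
      map_smul' := by intro a b; ext <;> simp <;> ring }

/-- Real and imaginary parts are `ℓ v / 2` and `-ℓ (i v) / 2`, so vanishing of the pairing with the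
gradient characterizes `H_z S`. -/
theorem pair_cplxPart (ℓ : C2 →L[ℝ] ℝ) (v : C2) :
    pair (cplxPart ℓ) v = (1 / 2) * ((ℓ v : ℂ) - Complex.I * (ℓ (Complex.I • v) : ℂ)) := by
  obtain ⟨⟨a, b⟩, ⟨c, d⟩⟩ := v
  have h1 : ((⟨a, b⟩, ⟨c, d⟩) : C2) = a • ((1 : ℂ), (0 : ℂ)) + b • (Complex.I, (0 : ℂ))
      + c • ((0 : ℂ), (1 : ℂ)) + d • ((0 : ℂ), Complex.I) := by
    ext <;> apply Complex.ext <;> simp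
  have h2 : Complex.I • ((⟨a, b⟩, ⟨c, d⟩) : C2) = a • (Complex.I, (0 : ℂ))
      + (-b) • ((1 : ℂ), (0 : ℂ)) + c • ((0 : ℂ), Complex.I) + (-d) • ((0 : ℂ), (1 : ℂ)) := by
    ext <;> apply Complex.ext <;> simp
  rw [h2, h1]
  simp only [map_add, map_smul]
  apply Complex.ext <;> simp [pair, cplxPart] <;> ring

/-- The gradient `(∂ρ/∂z₁, ∂ρ/∂z₂)`. -/
noncomputable def grad (ρ : C2 → ℝ) (z : C2) : C2 := cplxPart (fderiv ℝ ρ z)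

theorem mem_complexTangent_iff {ρ : C2 → ℝ} {z v : C2} :
    v ∈ complexTangent ρ z ↔ pair (grad ρ z) v = 0 := by
  rw [grad, pair_cplxPart, complexTangent, Set.mem_ofPred_eq, Complex.ext_iff]
  simp

theorem dualMap_eq (ρ : C2 → ℝ) (z : C2) :
    dualMap ρ z = (pair z (grad ρ z))⁻¹ • grad ρ z := by
  ext
  · exact (div_eq_inv_mul _ _)
  · exact (div_eq_inv_mul _ _)

theorem smul_mem_complexTangent {ρ : C2 → ℝ} {z v : C2} (c : ℂ) (hv : v ∈ complexTangent ρ z) :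
    c • v ∈ complexTangent ρ z := by
  rw [mem_complexTangent_iff] at *
  simp only [pair, Prod.smul_fst, Prod.smul_snd, smul_eq_mul] at *
  linear_combination c * hv

theorem sub_mem_complexTangent {ρ : C2 → ℝ} {z v w : C2} (hv : v ∈ complexTangent ρ z)
    (hw : w ∈ complexTangent ρ z) : v - w ∈ complexTangent ρ z := by
  rw [mem_complexTangent_iff] at *
  simp only [pair, Prod.fst_sub, Prod.snd_sub] at *
  linear_combination hv - hw

theorem IsDefiningFunction.contDiffAt {ρ : C2 → ℝ} {U S : Set C2}
    (hS : IsDefiningFunction ρ U S) {z : C2} (hz : z ∈ S) : ContDiffAt ℝ ∞ ρ z := by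
  rw [hS.zeroSet] at hz
  exact hS.contDiffOn.contDiffAt (hS.isOpen.mem_nhds hz.1)

theorem hasFDerivAt_fderiv {E F : Type*} [NormedAddCommGroup E] [NormedSpace ℝ E]
    [NormedAddCommGroup F] [NormedSpace ℝ F] {f : E → F} {z : E} (hf : ContDiffAt ℝ ∞ f z) :
    HasFDerivAt (fun y => fderiv ℝ f y) (fderiv ℝ (fun y => fderiv ℝ f y) z) z :=
  ((hf.fderiv_right (m := 1) (by norm_num; exact ENat.LEInfty.out)).differentiableAt
    (by simp)).hasFDerivAt

theorem hasFDerivAt_grad {ρ : C2 → ℝ} {z : C2} (hρ : ContDiffAt ℝ ∞ ρ z) :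
    HasFDerivAt (grad ρ) (cplxPart.comp (fderiv ℝ (fun y => fderiv ℝ ρ y) z)) z :=
  cplxPart.hasFDerivAt.comp z (hasFDerivAt_fderiv hρ)

theorem fderiv_fderiv_symm {F : Type*} [NormedAddCommGroup F] [NormedSpace ℝ F] {f : C2 → F}
    {z : C2} (hf : ContDiffAt ℝ ∞ f z) (v w : C2) :
    fderiv ℝ (fun y => fderiv ℝ f y) z v w = fderiv ℝ (fun y => fderiv ℝ f y) z w v :=
  (hf.isSymmSndFDerivAt (by simpa using ENat.LEInfty.out)).eq v w

theorem pair_self_grad_ne_zero {ρ : C2 → ℝ} {S : Set C2} (h : TangentLinesAvoidOrigin ρ S)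
    {z : C2} (hz : z ∈ S) : pair z (grad ρ z) ≠ 0 := by
  intro h0
  refine h z hz (-z) (mem_complexTangent_iff.2 ?_) (add_neg_cancel z)
  simp only [pair, Prod.fst_neg, Prod.snd_neg] at *
  linear_combination -h0

/-- The pairing as a continuous bilinear map. -/
noncomputable def pairL : C2 →L[ℝ] C2 →L[ℝ] ℂ :=
  LinearMap.toContinuousLinearMap
    { toFun := fun a => LinearMap.toContinuousLinearMap
        { toFun := fun b => pair a b
          map_add' := by intro b c; simp [pair]; ring
          map_smul' := by intro b c; simp [pair]; ring }
      map_add' := by intro b c; ext <;> simp [pair] <;> ring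
      map_smul' := by intro b c; ext <;> simp [pair] <;> ring }

@[simp] theorem pairL_apply (a b : C2) : pairL a b = pair a b := rfl

theorem _root_.HasFDerivAt.pair {f g : C2 → C2} {f' g' : C2 →L[ℝ] C2} {z : C2}
    (hf : HasFDerivAt f f' z) (hg : HasFDerivAt g g' z) :
    ∃ h' : C2 →L[ℝ] ℂ, HasFDerivAt (fun y => pair (f y) (g y)) h' z ∧
      ∀ v, h' v = pair (f z) (g' v) + pair (f' v) (g z) :=
  ⟨_, pairL.hasFDerivAt_of_bilinear hf hg, fun v => by simp⟩

/-! ### The dual map and its differential -/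

section DualMap

variable {ρ : C2 → ℝ} {z : C2}

theorem differentiableAt_dualMap (hρ : ContDiffAt ℝ ∞ ρ z) (hs : pair z (grad ρ z) ≠ 0) :
    DifferentiableAt ℝ (dualMap ρ) z := by
  obtain ⟨s', hs', -⟩ := (hasFDerivAt_id (𝕜 := ℝ) z).pair (hasFDerivAt_grad hρ)
  rw [show dualMap ρ = fun y => (pair y (grad ρ y))⁻¹ • grad ρ y from funext (dualMap_eq ρ)]
  exact (DifferentiableAt.inv hs'.differentiableAt hs).smul (hasFDerivAt_grad hρ).differentiableAt

theorem eventually_pair_self_grad_ne_zero (hρ : ContDiffAt ℝ ∞ ρ z)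
    (hs : pair z (grad ρ z) ≠ 0) : ∀ᶠ y in 𝓝 z, pair y (grad ρ y) ≠ 0 := by
  obtain ⟨s', hs', -⟩ := (hasFDerivAt_id (𝕜 := ℝ) z).pair (hasFDerivAt_grad hρ)
  exact hs'.continuousAt.eventually_ne hs

/-- The derivative of the incidence relation `z₁w₁ + z₂w₂ = 1`. -/
theorem pair_fderiv_dualMap (hρ : ContDiffAt ℝ ∞ ρ z) (hs : pair z (grad ρ z) ≠ 0) (v : C2) :
    pair z (fderiv ℝ (dualMap ρ) z v) + pair v (dualMap ρ z) = 0 := by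
  obtain ⟨h', hh, h2⟩ := (hasFDerivAt_id (𝕜 := ℝ) z).pair
    (differentiableAt_dualMap hρ hs).hasFDerivAt
  have h3 : h' = 0 := by
    refine hh.unique ((hasFDerivAt_const (1 : ℂ) z).congr_of_eventuallyEq ?_)
    filter_upwards [eventually_pair_self_grad_ne_zero hρ hs] with y hy
    rw [dualMap_eq]
    simp only [pair, Prod.smul_fst, Prod.smul_snd, smul_eq_mul, id] at *
    field_simp
  have h4 := h2 v
  rw [h3] at h4
  simpa using h4.symm

/-- By the differentiated incidence relation `z · dw(v) = -v · w`, and `w` is a nonzero multiple of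
the gradient. -/
theorem mem_complexTangent_iff_pair_fderiv_dualMap (hρ : ContDiffAt ℝ ∞ ρ z)
    (hs : pair z (grad ρ z) ≠ 0) {v : C2} :
    v ∈ complexTangent ρ z ↔ pair z (fderiv ℝ (dualMap ρ) z v) = 0 := by
  have h1 := pair_fderiv_dualMap hρ hs v
  have h2 : pair v (dualMap ρ z) = (pair z (grad ρ z))⁻¹ * pair (grad ρ z) v := by
    rw [dualMap_eq]
    simp only [pair, Prod.smul_fst, Prod.smul_snd, smul_eq_mul]
    ring
  rw [mem_complexTangent_iff, eq_neg_of_add_eq_zero_left h1, h2]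
  simp [hs]

/-- On the complex tangent space the derivative of the dual map is given by the Hessian. -/
theorem pair_fderiv_dualMap_of_mem (hρ : ContDiffAt ℝ ∞ ρ z) (hs : pair z (grad ρ z) ≠ 0)
    {a : C2} (ha : a ∈ complexTangent ρ z) (v : C2) :
    pair z (grad ρ z) * pair (fderiv ℝ (dualMap ρ) z v) a =
      (1 / 2) * ((fderiv ℝ (fun y => fderiv ℝ ρ y) z v a : ℂ)
        - Complex.I * (fderiv ℝ (fun y => fderiv ℝ ρ y) z v (Complex.I • a) : ℂ)) := by
  obtain ⟨s', hs', -⟩ := (hasFDerivAt_id (𝕜 := ℝ) z).pair (hasFDerivAt_grad hρ)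
  obtain ⟨h', hh, h2⟩ := (differentiableAt_dualMap hρ hs).hasFDerivAt.pair (hasFDerivAt_const a z)
  obtain ⟨k', hk, k2⟩ := (hasFDerivAt_grad hρ).pair (hasFDerivAt_const a z)
  -- Near `z`, `pair y (grad ρ y) * pair (dualMap ρ y) a = pair (grad ρ y) a` with `a` fixed. On
  -- differentiating, the term with `s'` drops out because `pair (dualMap ρ z) a = 0`.
  have h3 := (hs'.mul hh).unique (hk.congr_of_eventuallyEq (by
    filter_upwards [eventually_pair_self_grad_ne_zero hρ hs] with y hy
    change pair y (grad ρ y) * pair (dualMap ρ y) a = _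
    rw [dualMap_eq]
    simp only [pair, Prod.smul_fst, Prod.smul_snd, smul_eq_mul] at *
    field_simp))
  have h4 := DFunLike.congr_fun h3 v
  rw [k2 v] at h4
  have h5 : pair (dualMap ρ z) a = 0 := by
    rw [mem_complexTangent_iff] at ha
    rw [dualMap_eq]
    simp only [pair, Prod.smul_fst, Prod.smul_snd, smul_eq_mul] at *
    linear_combination (z.1 * (grad ρ z).1 + z.2 * (grad ρ z).2)⁻¹ * ha
  rw [← pair_cplxPart]
  have h0 : ∀ b : C2, pair b 0 = 0 := by simp [pair]
  simpa [h2 v, h5, h0] using h4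

variable {U S : Set C2}

/-- The dual map of a strongly `ℂ`-convex hypersurface is a local diffeomorphism. -/
theorem fderiv_dualMap_inverse_apply (hS : IsDefiningFunction ρ U S)
    (hconv : IsStronglyCConvex ρ S) (horigin : TangentLinesAvoidOrigin ρ S) (hz : z ∈ S)
    (y : C2) : fderiv ℝ (dualMap ρ) z ((fderiv ℝ (dualMap ρ) z).inverse y) = y := by
  have hρ := hS.contDiffAt hz
  have hs := pair_self_grad_ne_zero horigin hz
  set A := fderiv ℝ (dualMap ρ) z with hA
  have hinj : Function.Injective A.toLinearMap := by
    rw [injective_iff_map_eq_zero]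
    intro v hv
    have hv' : A v = 0 := hv
    by_contra hne
    -- A kernel vector lies in `H_z S`, where the real part of the Hessian formula gives Hessian
    -- zero on `v`, against convexity.
    have hvH : v ∈ complexTangent ρ z := by
      rw [mem_complexTangent_iff_pair_fderiv_dualMap hρ hs, ← hA, hv']
      simp [pair]
    have h1 := pair_fderiv_dualMap_of_mem hρ hs hvH v
    rw [← hA, hv'] at h1
    have h2 := congrArg Complex.re h1
    have h3 := hconv z hz v hvH hne
    simp [pair] at h2
    linarith
  let e : C2 ≃L[ℝ] C2 := (LinearEquiv.ofInjectiveEndo A.toLinearMap hinj).toContinuousLinearEquiv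
  have he : (e : C2 →L[ℝ] C2) = A := by ext v <;> rfl
  rw [← he, ContinuousLinearMap.inverse_equiv]
  exact e.apply_symm_apply y

/-- A function killed at `z` by the `(0,1)` vectors and by the conjugate of the dual field is
killed by the whole complex tangent space. -/
theorem apply_eq_zero_of_mem_complexTangent (hS : IsDefiningFunction ρ U S)
    (hconv : IsStronglyCConvex ρ S) (horigin : TangentLinesAvoidOrigin ρ S) (hz : z ∈ S)
    {D : C2 →L[ℝ] ℂ}
    (hcr : ∀ v ∈ complexTangent ρ z,
      D (CVec.holo v).conj.re + Complex.I * D (CVec.holo v).conj.im = 0)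
    (hdual : D (dualField ρ z).conj.re + Complex.I * D (dualField ρ z).conj.im = 0) :
    ∀ v ∈ complexTangent ρ z, D v = 0 := by
  have hρ := hS.contDiffAt hz
  have hs := pair_self_grad_ne_zero horigin hz
  have hinv := fderiv_dualMap_inverse_apply hS hconv horigin hz
  have hmem := fun v => mem_complexTangent_iff_pair_fderiv_dualMap hρ hs (v := v)
  have hpair := fun a ha v => pair_fderiv_dualMap_of_mem hρ hs (a := a) ha v
  set A := fderiv ℝ (dualMap ρ) z with hA
  set ζ : C2 := (z.2, -z.1) with hζ
  have hzζ : ∀ c : ℂ, pair z (c • ζ) = 0 := by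
    intro c; simp [pair, hζ]; ring
  have hI : ∀ v ∈ complexTangent ρ z, D (Complex.I • v) = Complex.I * D v := by
    intro v hv
    have h1 := hcr ((2 : ℂ) • v) (smul_mem_complexTangent 2 hv)
    have e1 : (1 / 2 : ℂ) • ((2 : ℂ) • v) = v := by ext <;> simp
    have e2 : (Complex.I / 2 : ℂ) • ((2 : ℂ) • v) = Complex.I • v := by ext <;> simp <;> ring
    simp only [CVec.holo, CVec.conj, neg_neg, e1, e2] at h1
    linear_combination (-Complex.I) * h1 + D (Complex.I • v) * Complex.I_mul_I
  obtain ⟨a, ha⟩ : ∃ a, a = A.inverse ((1 / 2 : ℂ) • ζ) := ⟨_, rfl⟩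
  obtain ⟨b, hb⟩ : ∃ b, b = A.inverse ((Complex.I / 2 : ℂ) • ζ) := ⟨_, rfl⟩
  have hAa : A a = (1 / 2 : ℂ) • ζ := by rw [ha, hinv]
  have hAb : A b = (Complex.I / 2 : ℂ) • ζ := by rw [hb, hinv]
  have haH : a ∈ complexTangent ρ z := by rw [hmem, hAa, hzζ]
  have hbH : b ∈ complexTangent ρ z := by rw [hmem, hAb, hzζ]
  have hab : D a + Complex.I * D b = 0 := by
    simpa only [dualField, CVec.map, CVec.holo, CVec.conj, map_neg, neg_neg, ← hA, ← hζ, ← ha,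
      ← hb] using hdual
  have ha0 : a ≠ 0 := by
    rintro rfl
    rw [map_zero] at hAa
    have h1 : ζ = 0 := by simpa using hAa.symm
    simp only [hζ, Prod.mk_eq_zero, neg_eq_zero] at h1
    exact hs (by simp [pair, h1.1, h1.2])
  have hIa0 : Complex.I • a ≠ 0 := smul_ne_zero Complex.I_ne_zero ha0
  have hIaH := smul_mem_complexTangent Complex.I haH
  -- The conjugate of `V` is `a + i b`, so `D b = i D a`; CR gives `D (i a) = i D a`. Thus `D c =
  -- 0`, and `c` spans the complex line `H_z S` once it is nonzero.
  obtain ⟨c, hc⟩ : ∃ c, c = b - Complex.I • a := ⟨_, rfl⟩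
  have hcH : c ∈ complexTangent ρ z := hc ▸ sub_mem_complexTangent hbH hIaH
  have hc0 : c ≠ 0 := by
    intro h0
    -- If `c = 0`, the dual map's differential commutes with `i` on `a`; the Hessian formula for `a`
    -- and `i a` then forces the two Hessian values to be opposite, though both are positive.
    have hbI : b = Complex.I • a := sub_eq_zero.1 (hc ▸ h0)
    rw [hbI] at hAb
    have p1 := hpair a haH a
    have p2 := hpair a haH (Complex.I • a)
    rw [hAa] at p1
    rw [hAb] at p2
    have p3 : pair ((Complex.I / 2 : ℂ) • ζ) a = Complex.I * pair ((1 / 2 : ℂ) • ζ) a := by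
      simp only [pair, Prod.smul_fst, Prod.smul_snd, smul_eq_mul]; ring
    rw [p3] at p2
    have p4 := congrArg Complex.im (p2.symm.trans ((mul_left_comm _ _ _).trans
      (congrArg (Complex.I * ·) p1)))
    have q1 := hconv z hz a haH ha0
    have q2 := hconv z hz _ hIaH hIa0
    simp at p4
    linarith
  have hDc : D c = 0 := by
    rw [hc, map_sub, hI a haH]
    linear_combination (-Complex.I) * hab + D b * Complex.I_mul_I
  have hq0 : grad ρ z ≠ 0 := fun h => hs (by rw [h]; simp [pair])
  intro v hv
  obtain ⟨t, ht⟩ : ∃ t : ℂ, v = t • c := by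
    rw [mem_complexTangent_iff] at hv hcH
    simp only [pair] at hv hcH
    have hdet : v.1 * c.2 = v.2 * c.1 := by
      by_cases h1 : (grad ρ z).1 = 0
      · have h2 : (grad ρ z).2 ≠ 0 := fun h2 => hq0 (Prod.ext h1 h2)
        apply mul_left_cancel₀ h2
        linear_combination v.1 * hcH - c.1 * hv
      · apply mul_left_cancel₀ h1
        linear_combination c.2 * hv - v.2 * hcH
    by_cases h1 : c.1 = 0
    · have h2 : c.2 ≠ 0 := fun h2 => hc0 (Prod.ext h1 h2)
      refine ⟨v.2 / c.2, Prod.ext ?_ ?_⟩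
      · simp only [Prod.smul_fst, smul_eq_mul]; field_simp; linear_combination hdet
      · simp only [Prod.smul_snd, smul_eq_mul]; field_simp
    · refine ⟨v.1 / c.1, Prod.ext ?_ ?_⟩
      · simp only [Prod.smul_fst, smul_eq_mul]; field_simp
      · simp only [Prod.smul_snd, smul_eq_mul]; field_simp; linear_combination -hdet
  have ht' : v = t.re • c + t.im • (Complex.I • c) := by
    rw [ht]
    ext <;> simp
    · linear_combination (-c.1) * Complex.re_add_im t
    · linear_combination (-c.2) * Complex.re_add_im t
  rw [ht', map_add, map_smul, map_smul, hI c hcH, hDc]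
  simp

/-- If all derivatives of `F` along the complex tangent spaces vanish, then all its tangential
derivatives vanish. -/
theorem fderiv_eq_zero_of_complexTangent (hS : IsDefiningFunction ρ U S)
    (hconv : IsStronglyCConvex ρ S) (hz : z ∈ S) {F : C2 → ℂ} (hF : ContDiffAt ℝ ∞ F z)
    (h0 : ∀ᶠ y in 𝓝 z, y ∈ S → ∀ v ∈ complexTangent ρ y, fderiv ℝ F y v = 0) {X : C2}
    (hX : fderiv ℝ ρ z X = 0) : fderiv ℝ F z X = 0 := by
  have hρ := hS.contDiffAt hz
  -- `J` turns the gradient into a frame of the complex tangent lines.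
  let J : C2 →L[ℝ] C2 :=
    (ContinuousLinearMap.snd ℝ ℂ ℂ).prod (-ContinuousLinearMap.fst ℝ ℂ ℂ)
  have hJ : ∀ a, J a = (a.2, -a.1) := fun a => rfl
  have hJanti : ∀ a b, pair a (J b) = -pair b (J a) := by
    intro a b; simp [pair, hJ]; ring
  let M : C2 →L[ℝ] C2 := (LinearMap.lsmul ℂ C2 Complex.I).restrictScalars ℝ |>.toContinuousLinearMap
  have hM : ∀ a, M a = Complex.I • a := fun a => rfl
  set H := fderiv ℝ (fun y => fderiv ℝ ρ y) z with hH
  set F₂ := fderiv ℝ (fun y => fderiv ℝ F y) z with hF₂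
  have hv' := J.hasFDerivAt.comp z (hasFDerivAt_grad hρ)
  have hvH : ∀ y, J (grad ρ y) ∈ complexTangent ρ y := by
    intro y
    rw [mem_complexTangent_iff]
    simp [pair, hJ]; ring
  obtain ⟨v, hv⟩ : ∃ v, v = J (grad ρ z) := ⟨_, rfl⟩
  have hvH' : v ∈ complexTangent ρ z := hv ▸ hvH z
  have hIvH := smul_mem_complexTangent Complex.I hvH'
  have hv0 : v ≠ 0 := by
    intro h
    refine hS.fderiv_ne_zero z hz (ContinuousLinearMap.ext fun w => ?_)
    have hg : grad ρ z = 0 := by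
      rw [hv, hJ] at h
      simp only [Prod.mk_eq_zero, neg_eq_zero] at h
      exact Prod.ext h.2 h.1
    have h1 := pair_cplxPart (fderiv ℝ ρ z) w
    change pair (grad ρ z) w = _ at h1
    rw [hg] at h1
    have h2 := congrArg Complex.re h1
    simpa [pair] using h2.symm
  have hFd := hasFDerivAt_fderiv hF
  have e1 := hS.fderiv_apply_eq_zero hz (hFd.clm_apply hv')
    (h0.mono fun y hy hyS => hy hyS _ (hvH y)) hIvH.1
  have e2 := hS.fderiv_apply_eq_zero hz (hFd.clm_apply (M.hasFDerivAt.comp z hv'))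
    (h0.mono fun y hy hyS => hy hyS _ (smul_mem_complexTangent _ (hvH y))) hvH'.1
  simp only [add_apply, ContinuousLinearMap.comp_apply,
    ContinuousLinearMap.flip_apply, Function.comp_apply, ← hv, ← hF₂, ← hH, hM] at e1 e2
  -- `B` is, up to sign, the Lie bracket at `z` of the fields `J (grad ρ)` and `i J (grad ρ)`.
  -- Subtracting `e2` from `e1` cancels the second derivatives of `F` by symmetry.
  obtain ⟨B, hB⟩ : ∃ B, B = J (cplxPart (H (Complex.I • v))) - Complex.I • J (cplxPart (H v)) :=
    ⟨_, rfl⟩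
  have hFB : fderiv ℝ F z B = 0 := by
    rw [hB, map_sub]
    have := fderiv_fderiv_symm hF v (Complex.I • v)
    rw [← hF₂] at this
    linear_combination e1 - e2 + this
  -- The Levi form on `v`, up to a positive factor. `pair (grad ρ z) B = i κ` says that `B` is
  -- tangent to `S` but outside `H_z S`.
  obtain ⟨κ, hκ⟩ : ∃ κ : ℝ, κ = (H v v + H (Complex.I • v) (Complex.I • v)) / 2 := ⟨_, rfl⟩
  have hκ0 : 0 < κ := by
    have q1 := hconv z hz v hvH' hv0
    have q2 := hconv z hz _ hIvH (smul_ne_zero Complex.I_ne_zero hv0)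
    rw [← hH] at q1 q2
    rw [hκ]; linarith
  have hpB : pair (grad ρ z) B = Complex.I * κ := by
    have r1 : pair (grad ρ z) B = pair (grad ρ z) (J (cplxPart (H (Complex.I • v))))
        - Complex.I * pair (grad ρ z) (J (cplxPart (H v))) := by
      rw [hB]; simp [pair]; ring
    rw [r1, hJanti _ (cplxPart (H (Complex.I • v))), hJanti _ (cplxPart (H v)),
      ← hv, pair_cplxPart, pair_cplxPart]
    have := fderiv_fderiv_symm hρ v (Complex.I • v)
    rw [← hH] at this
    rw [this, hκ]
    push_cast
    linear_combination (1 / 2 : ℂ) * (-(H (Complex.I • v) v : ℂ)) * Complex.I_mul_I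
  have hpX := pair_cplxPart (fderiv ℝ ρ z) X
  change pair (grad ρ z) X = _ at hpX
  rw [hX] at hpX
  -- Chosen to match `pair (grad ρ z) X = -(i/2) dρ(i X)` with `t i κ`.
  obtain ⟨t, ht⟩ : ∃ t : ℝ, t = -(fderiv ℝ ρ z (Complex.I • X)) / (2 * κ) := ⟨_, rfl⟩
  have hXB : X - t • B ∈ complexTangent ρ z := by
    rw [mem_complexTangent_iff]
    have r1 : pair (grad ρ z) (X - t • B) = pair (grad ρ z) X - t * pair (grad ρ z) B := by
      simp [pair]; ring
    have hκc : (κ : ℂ) ≠ 0 := by exact_mod_cast hκ0.ne'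
    rw [r1, hpX, hpB, ht]
    push_cast
    field_simp
    ring
  have hfin := h0.self_of_nhds hz _ hXB
  rw [map_sub, map_smul, hFB] at hfin
  simpa using hfin

end DualMap

/-! ### Locality of the CR and dual-CR conditions -/

section SmoothAnnihilated

variable {Λ : C2 → Set CVec} {W W' : Set C2} {f g : C2 → ℂ}

theorem SmoothAnnihilated.mono (hf : SmoothAnnihilated Λ W f) (h : W' ⊆ W) :
    SmoothAnnihilated Λ W' f := by
  intro p hp
  obtain ⟨N, hN, hpN, F, hF, hFf, hF0⟩ := hf p (h hp)
  exact ⟨N, hN, hpN, F, hF, fun z hz => hFf z ⟨hz.1, h hz.2⟩, fun z hz => hF0 z ⟨hz.1, h hz.2⟩⟩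

theorem SmoothAnnihilated.sub (hf : SmoothAnnihilated Λ W f) (hg : SmoothAnnihilated Λ W g) :
    SmoothAnnihilated Λ W (fun z => f z - g z) := by
  intro p hp
  obtain ⟨N, hN, hpN, F, hF, hFf, hF0⟩ := hf p hp
  obtain ⟨M, hM, hpM, G, hG, hGg, hG0⟩ := hg p hp
  refine ⟨N ∩ M, hN.inter hM, ⟨hpN, hpM⟩, fun z => F z - G z,
    (hF.mono Set.inter_subset_left).sub (hG.mono Set.inter_subset_right), ?_, ?_⟩
  · intro z hz
    simp only [hFf z ⟨hz.1.1, hz.2⟩, hGg z ⟨hz.1.2, hz.2⟩]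
  · intro z hz L hL
    have h1 := hF0 z ⟨hz.1.1, hz.2⟩ L hL
    have h2 := hG0 z ⟨hz.1.2, hz.2⟩ L hL
    have d1 := (hF.contDiffAt (hN.mem_nhds hz.1.1)).differentiableAt (by simp)
    have d2 := (hG.contDiffAt (hM.mem_nhds hz.1.2)).differentiableAt (by simp)
    simp only [CVec.apply] at *
    rw [fderiv_fun_sub d1 d2, sub_apply, sub_apply]
    linear_combination h1 - h2

/-- Being smooth and annihilated is a local property, insensitive to additive constants. -/
theorem SmoothAnnihilated.of_locally_eq_add_const
    (h : ∀ p ∈ W, ∃ M : Set C2, IsOpen M ∧ p ∈ M ∧ ∃ (g : C2 → ℂ) (c : ℂ),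
      SmoothAnnihilated Λ (W ∩ M) g ∧ ∀ z ∈ W ∩ M, f z = g z + c) :
    SmoothAnnihilated Λ W f := by
  intro p hp
  obtain ⟨M, hM, hpM, g, c, hg, hfg⟩ := h p hp
  obtain ⟨N, hN, hpN, G, hG, hGg, hG0⟩ := hg p ⟨hp, hpM⟩
  refine ⟨N ∩ M, hN.inter hM, ⟨hpN, hpM⟩, fun z => G z + c,
    (hG.mono Set.inter_subset_left).add contDiffOn_const, ?_, ?_⟩
  · intro z hz
    simp only [hGg z ⟨hz.1.1, hz.2, hz.1.2⟩, hfg z ⟨hz.2, hz.1.2⟩]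
  · intro z hz L hL
    have h1 := hG0 z ⟨hz.1.1, hz.2, hz.1.2⟩ L hL
    simpa only [CVec.apply, fderiv_add_const] using h1

end SmoothAnnihilated

/-! ### Functions that are both CR and dual-CR -/

variable {ρ : C2 → ℝ} {U S : Set C2}

/-- The vector `(z₂, -z₁)` pairs to zero with `z`, so its pull-back lies in `H_z S`. Tangency allows
an extension adapted to one condition to be replaced by one adapted to the other. -/
theorem dualField_conj_tangent (hS : IsDefiningFunction ρ U S)
    (hconv : IsStronglyCConvex ρ S) (horigin : TangentLinesAvoidOrigin ρ S) {z : C2} (hz : z ∈ S) :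
    fderiv ℝ ρ z (dualField ρ z).conj.re = 0 ∧ fderiv ℝ ρ z (dualField ρ z).conj.im = 0 := by
  have hinv := fderiv_dualMap_inverse_apply hS hconv horigin hz
  have hmem := fun v => mem_complexTangent_iff_pair_fderiv_dualMap (hS.contDiffAt hz)
    (pair_self_grad_ne_zero horigin hz) (v := v)
  have key : ∀ c : ℂ, fderiv ℝ ρ z
      ((fderiv ℝ (dualMap ρ) z).inverse (c • ((z.2, -z.1) : C2))) = 0 := by
    intro c
    refine ((hmem _).2 ?_).1
    rw [hinv]
    simp [pair]; ring
  refine ⟨key _, ?_⟩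
  simp only [dualField, CVec.map, CVec.holo, CVec.conj, map_neg, neg_neg]
  exact key _

/-- A function which is both CR and dual-CR is locally constant. -/
theorem eventually_eq_of_isCROn_of_isDualCROn (hS : IsDefiningFunction ρ U S)
    (hconv : IsStronglyCConvex ρ S) (horigin : TangentLinesAvoidOrigin ρ S) {O : Set C2}
    (hO : IsOpen O) {f g : C2 → ℂ} (hf : IsCROn ρ (S ∩ O) f) (hg : IsDualCROn ρ (S ∩ O) g)
    (hfg : ∀ z ∈ S ∩ O, f z = g z) {p : C2} (hp : p ∈ S ∩ O) :
    ∀ᶠ z in 𝓝 p, z ∈ S → f z = f p := by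
  obtain ⟨N, hN, hpN, F, hF, hFf, hF0⟩ := hf p hp
  obtain ⟨M, hM, hpM, G, hG, hGg, hG0⟩ := hg p hp
  obtain ⟨D, hD⟩ : ∃ D : Set C2, D = N ∩ M ∩ O := ⟨_, rfl⟩
  have hDo : IsOpen D := hD ▸ (hN.inter hM).inter hO
  have hpD : p ∈ D := hD ▸ ⟨⟨hpN, hpM⟩, hp.2⟩
  have hFc : ∀ z ∈ D, ContDiffAt ℝ ∞ F z := fun z hz => by
    rw [hD] at hz
    exact hF.contDiffAt (hN.mem_nhds hz.1.1)
  have hGc : ∀ z ∈ D, ContDiffAt ℝ ∞ G z := fun z hz => by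
    rw [hD] at hz
    exact hG.contDiffAt (hM.mem_nhds hz.1.2)
  have hFG : ∀ z ∈ D, z ∈ S → F z - G z = 0 := by
    intro z hz hzS
    rw [hD] at hz
    rw [hFf z ⟨hz.1.1, hzS, hz.2⟩, hGg z ⟨hz.1.2, hzS, hz.2⟩, hfg z ⟨hzS, hz.2⟩, sub_self]
  have htan : ∀ z ∈ D, z ∈ S → ∀ v, fderiv ℝ ρ z v = 0 → fderiv ℝ F z v = fderiv ℝ G z v := by
    intro z hz hzS v hv
    have d1 := ((hFc z hz).differentiableAt (by simp)).hasFDerivAt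
    have d2 := ((hGc z hz).differentiableAt (by simp)).hasFDerivAt
    have := hS.fderiv_apply_eq_zero hzS (d1.sub d2)
      (Filter.eventually_of_mem (hDo.mem_nhds hz) hFG) hv
    exact sub_eq_zero.1 this
  have hH : ∀ z ∈ D, z ∈ S → ∀ v ∈ complexTangent ρ z, fderiv ℝ F z v = 0 := by
    intro z hz hzS
    refine apply_eq_zero_of_mem_complexTangent hS hconv horigin hzS ?_ ?_
    · intro v hv
      rw [hD] at hz
      exact hF0 z ⟨hz.1.1, hzS, hz.2⟩ _ ⟨v, hv, rfl⟩
    · obtain ⟨t1, t2⟩ := dualField_conj_tangent hS hconv horigin hzS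
      rw [htan z hz hzS _ t1, htan z hz hzS _ t2]
      rw [hD] at hz
      exact hG0 z ⟨hz.1.2, hzS, hz.2⟩ _ rfl
  have hT : ∀ z ∈ D ∩ S, ∀ v, fderiv ℝ ρ z v = 0 → fderiv ℝ F z v = 0 := by
    intro z hz v hv
    exact fderiv_eq_zero_of_complexTangent hS hconv hz.2 (hFc z hz.1)
      (Filter.eventually_of_mem (hDo.mem_nhds hz.1) hH) hv
  have hconst := hS.eventually_eq_of_fderiv_eq_zero hp.1 (hDo.mem_nhds hpD)
    (fun z hz => (hFc z hz.1).differentiableAt (by simp)) hT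
  filter_upwards [hconst, hDo.mem_nhds hpD] with z hz hzD hzS
  rw [hD] at hzD
  rw [← hFf z ⟨hzD.1.1, hzS, hzD.2⟩, ← hFf p ⟨hpN, hp⟩, hz hzS]

end DualCR

/-! ### From local to global decompositions -/

theorem corollary3p8 (ρ : DualCR.C2 → ℝ) (U S W O : Set DualCR.C2)
    (hS : DualCR.IsDefiningFunction ρ U S)
    (hconv : DualCR.IsStronglyCConvex ρ S)
    (horigin : DualCR.TangentLinesAvoidOrigin ρ S)
    (hO : IsOpen O) (hW : W = S ∩ O)
    (hsc : SimplyConnectedSpace W)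
    (u : DualCR.C2 → ℂ) (hu : DualCR.IsLocallyDecomposableOn ρ W u) :
    DualCR.IsDecomposableOn ρ W u := by
  have hlpc : LocallyPathConnectedSpace W := hW ▸ hS.locallyPathConnectedSpace hO
  choose! P hPo hpP f g hf hg hfg using hu
  have hdiff : ∀ i j : W, ∀ x ∈ (Subtype.val ⁻¹' P i : Set W) ∩ Subtype.val ⁻¹' P j,
      ∀ᶠ y : W in 𝓝 x, f i y - f j y = f i x - f j x := by
    rintro i j x ⟨hxi, hxj⟩
    have hsub : S ∩ (O ∩ (P i ∩ P j)) = W ∩ P i ∩ P j := by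
      simp only [← Set.inter_assoc, ← hW]
    have hi : S ∩ (O ∩ (P i ∩ P j)) ⊆ W ∩ P i := hsub ▸ Set.inter_subset_left
    have hj : S ∩ (O ∩ (P i ∩ P j)) ⊆ W ∩ P j :=
      hsub ▸ fun z hz => ⟨hz.1.1, hz.2⟩
    have hloc := DualCR.eventually_eq_of_isCROn_of_isDualCROn hS hconv horigin
      (hO.inter ((hPo i i.2).inter (hPo j j.2)))
      (((hf i i.2).mono hi).sub ((hf j j.2).mono hj))
      (((hg j j.2).mono hj).sub ((hg i i.2).mono hi))
      (fun z hz => by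
        have h1 := hfg i i.2 z (hi hz)
        have h2 := hfg j j.2 z (hj hz)
        linear_combination h2 - h1) (p := x) (hsub ▸ ⟨⟨x.2, hxi⟩, hxj⟩)
    filter_upwards [continuous_subtype_val.continuousAt.eventually hloc] with y hy
    exact hy (hW ▸ y.2 : (y : DualCR.C2) ∈ S ∩ O).1
  obtain ⟨F, hF⟩ := exists_eventually_sub_eq_of_simplyConnected
    (fun i : W => (Subtype.val ⁻¹' P i : Set W))
    (fun i => (hPo i i.2).preimage continuous_subtype_val) (fun x => ⟨x, hpP x x.2⟩)
    (fun i y => f i y) hdiff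
  classical
  -- Extension by zero; values off `W` play no role.
  obtain ⟨f', hf'⟩ : ∃ f' : DualCR.C2 → ℂ, ∀ x : W, f' x = F x :=
    ⟨fun z => if h : z ∈ W then F ⟨z, h⟩ else 0, fun x => by simp⟩
  have hloc : ∀ p ∈ W, ∃ M : Set DualCR.C2, IsOpen M ∧ p ∈ M ∧ M ⊆ P p ∧ ∃ c : ℂ,
      ∀ z ∈ W ∩ M, f' z = f p z + c := by
    intro p hp
    obtain ⟨N, hN, hNs⟩ := (mem_nhds_subtype _ _ _).1 (hF ⟨p, hp⟩ ⟨p, hp⟩ (hpP p hp))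
    obtain ⟨M, hMN, hMo, hpM⟩ := mem_nhds_iff.1 hN
    refine ⟨M ∩ P p, hMo.inter (hPo p hp), ⟨hpM, hpP p hp⟩, Set.inter_subset_right,
      F ⟨p, hp⟩ - f p p, ?_⟩
    rintro z ⟨hzW, hzM, -⟩
    have h1 : F ⟨z, hzW⟩ - f p z = F ⟨p, hp⟩ - f p p :=
      hNs (show (⟨z, hzW⟩ : W) ∈ Subtype.val ⁻¹' N from hMN hzM)
    rw [hf' ⟨z, hzW⟩]
    linear_combination h1
  refine ⟨f', fun z => u z - f' z, ?_, ?_, fun z _ => by ring⟩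
  · refine DualCR.SmoothAnnihilated.of_locally_eq_add_const fun p hp => ?_
    obtain ⟨M, hM, hpM, hMP, c, hc⟩ := hloc p hp
    exact ⟨M, hM, hpM, f p, c, (hf p hp).mono (Set.inter_subset_inter_right _ hMP), hc⟩
  · refine DualCR.SmoothAnnihilated.of_locally_eq_add_const fun p hp => ?_
    obtain ⟨M, hM, hpM, hMP, c, hc⟩ := hloc p hp
    refine ⟨M, hM, hpM, g p, -c, (hg p hp).mono (Set.inter_subset_inter_right _ hMP), ?_⟩
    intro z hz
    rw [hc z hz, hfg p hp z ⟨hz.1, hMP hz.2⟩]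
    ring
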